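/- For $e\in\mathbb N_0$ let $k=k_e$ be the largest natural number with $\binom{k}{2}\le e$, let $t=t_e=e-\binom{k_e}{2}$, and let $b_e=1$ if $e=0$, $b_e=k_e+1$ if $t_e=0$ and $e\ne 0$, and $b_e=k_e+2$ if $t_e\ne0$. For a finite simple graph $G$ let $\rho(G)$ be its spectral radius, that is, the largest modulus of an eigenvalue of its adjacency matrix. Write $G_1\vee G_2$ for the join and $G_1+G_2$ for the disjoint union of graphs, and $rK_1$ for the graph with $r$ vertices and no edges. For $n\ge b_e$ let $$\mathcal D_{n,e}=\begin{cases}\big(\big((K_{k-t}+K_1)\vee K_{t}\big)+(n-k-2)K_1\big)\vee K_1,& n\ge k+2,\\ K_n,& n<k+2.\end{cases}$$ For $e\ge4$ let $$\begin{aligned}\Psi_e(\lambda)={}&\lambda^3(k-1)(k-2)(k^2-3k+4t)\\&-\lambda^2\big(k^5-6k^4+k^3(4t+15)-k^2(20t+18)+k(8t^2+24t+8)-(4t^2+12t)\big)\\&-\lambda(k^2-k+2t)\big(k^3+k^2(t-4)-k(3t-5)+(4t^2-2t-2)\big)\\&+t(k-t-1)(k^2-3k+2t)(k^2-k+2t),\end{aligned}$$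 let $\psi_e$ be the largest real root of $\Psi_e$, and let $$\omega_e=e+2+\frac{\psi_e(\psi_e+1)(\psi_e^2-\psi_e-2e)}{\psi_e^2-e}.$$ **Proposition.** For every integer $e\ge4$, the numbers $\psi_e$ and $\omega_e$ are well defined (the polynomial $\Psi_e$ has a largest real root, and $\psi_e^2\neq e$), and $\omega_e>e+2$. Moreover, for every natural number $n$: 1. if $b_e\le n<\omega_e$, then $\rho(\mathcal D_{n,e})<\psi_e$; 2. if $n=\omega_e$, then $\rho(\mathcal D_{n,e})=\psi_e$; 3. if $n>\omega_e$, then $\rho(\mathcal D_{n,e})>\psi_e$. (Since $\omega_e>e+2\ge b_e$, the graph $\mathcal D_{n,e}$ is defined in all three cases.) -/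

import Mathlib

open Polynomial

/-- The join `G ∨ H`: the disjoint union of `G` and `H` with all edges between the two added. -/
def graphJoin {V W : Type} (G : SimpleGraph V) (H : SimpleGraph W) : SimpleGraph (V ⊕ W) :=
  (G ⊕g H) ⊔ completeBipartiteGraph V W

/-- A finite simple graph together with its vertex type. -/
structure FinGraph where
  V : Type
  [fintypeV : Fintype V]
  graph : SimpleGraph V

attribute [instance] FinGraph.fintypeV

open Classical in
/-- The spectral radius `ρ(G)`: the largest modulus of an eigenvalue of the adjacency matrix.
Mathlib's `spectralRadius` is `ℝ≥0∞`-valued; it is finite here, see `FinGraph.isGreatest_rho`. -/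
noncomputable def FinGraph.rho (G : FinGraph) : ℝ :=
  (spectralRadius ℂ (G.graph.adjMatrix ℂ)).toReal

open Classical in
theorem FinGraph.isGreatest_rho (G : FinGraph) [Nonempty G.V] :
    IsGreatest {r : ℝ | ∃ μ : ℂ, ‖μ‖ = r ∧ ∃ x : G.V → ℂ, x ≠ 0 ∧
      (G.graph.adjMatrix ℂ).mulVec x = μ • x} G.rho := by
  set A := G.graph.adjMatrix ℂ with hA
  have key : ∀ μ : ℂ, μ ∈ spectrum ℂ A ↔ ∃ x : G.V → ℂ, x ≠ 0 ∧ A.mulVec x = μ • x := by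
    intro μ
    rw [← Matrix.spectrum_toLin', ← Module.End.hasEigenvalue_iff_mem_spectrum]
    constructor
    · intro h
      obtain ⟨x, hx⟩ := h.exists_hasEigenvector
      exact ⟨x, hx.2, by simpa using hx.apply_eq_smul⟩
    · rintro ⟨x, hx0, hx⟩
      exact Module.End.hasEigenvalue_of_hasEigenvector (x := x)
        ⟨Module.End.mem_eigenspace_iff.2 (by simpa using hx), hx0⟩
  have hfin : (spectrum ℂ A).Finite := Matrix.finite_spectrum A
  have hne : (spectrum ℂ A).Nonempty := spectrum.nonempty_of_isAlgClosed_of_finiteDimensional ℂ A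
  obtain ⟨μ₀, hμ₀, hmax⟩ := hfin.exists_maximalFor (fun μ : ℂ => ‖μ‖) _ hne
  have hle : ∀ μ ∈ spectrum ℂ A, ‖μ‖ ≤ ‖μ₀‖ := fun μ hμ =>
    (le_total ‖μ‖ ‖μ₀‖).elim id fun h => hmax hμ h
  have hrad : spectralRadius ℂ A = (‖μ₀‖₊ : ENNReal) := by
    refine le_antisymm (iSup₂_le fun μ hμ => ?_) (le_iSup₂_of_le μ₀ hμ₀ le_rfl)
    exact_mod_cast hle μ hμ
  have hrho : G.rho = ‖μ₀‖ := by
    rw [FinGraph.rho, ← hA, hrad]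
    simp
  rw [hrho]
  refine ⟨⟨μ₀, rfl, (key μ₀).1 hμ₀⟩, ?_⟩
  rintro r ⟨μ, rfl, hx⟩
  exact hle μ ((key μ).2 hx)

/-- `k_e`: the largest natural number `k` with `k.choose 2 ≤ e`. -/
def kNum (e : ℕ) : ℕ := Nat.findGreatest (fun k => k.choose 2 ≤ e) (e + 1)

theorem isGreatest_kNum (e : ℕ) : IsGreatest {k : ℕ | k.choose 2 ≤ e} (kNum e) := by
  refine ⟨Nat.findGreatest_spec (P := fun k => k.choose 2 ≤ e) (Nat.zero_le _) (by simp), ?_⟩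
  intro k hk
  refine Nat.le_findGreatest ?_ hk
  have hk : k.choose 2 ≤ e := hk
  rcases k with _ | k
  · omega
  · rw [Nat.choose_succ_succ' k 1, Nat.choose_one_right] at hk
    omega

/-- `t_e = e - k_e.choose 2`. -/
def tNum (e : ℕ) : ℕ := e - (kNum e).choose 2

theorem choose_kNum_add_tNum (e : ℕ) : (kNum e).choose 2 + tNum e = e :=
  Nat.add_sub_of_le (isGreatest_kNum e).1

/-- `b_e`: the least order of a connected graph with `e` more edges than a spanning tree. -/
def bNum (e : ℕ) : ℕ :=
  if e = 0 then 1 else if tNum e = 0 then kNum e + 1 else kNum e + 2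

/-- The graph `D_{n,e}`, i.e. `(((K_{k-t} + K_1) ∨ K_t) + (n-k-2) K_1) ∨ K_1` if `n ≥ k + 2`,
and `K_n` otherwise, where `k = k_e` and `t = t_e`. -/
def graphD (n e : ℕ) : FinGraph :=
  if kNum e + 2 ≤ n then
    ⟨_, graphJoin
      ((graphJoin
          (SimpleGraph.completeGraph (Fin (kNum e - tNum e)) ⊕g SimpleGraph.completeGraph (Fin 1))
          (SimpleGraph.completeGraph (Fin (tNum e))))
        ⊕g SimpleGraph.emptyGraph (Fin (n - kNum e - 2)))
      (SimpleGraph.completeGraph (Fin 1))⟩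
  else ⟨_, SimpleGraph.completeGraph (Fin n)⟩

/-- The polynomial `Ψ_e(λ)`, with `k = k_e` and `t = t_e`. -/
noncomputable def PsiPoly (e : ℕ) : ℝ[X] :=
  let k : ℝ := kNum e
  let t : ℝ := tNum e
  C ((k - 1) * (k - 2) * (k ^ 2 - 3 * k + 4 * t)) * X ^ 3
  - C (k ^ 5 - 6 * k ^ 4 + k ^ 3 * (4 * t + 15) - k ^ 2 * (20 * t + 18)
      + k * (8 * t ^ 2 + 24 * t + 8) - (4 * t ^ 2 + 12 * t)) * X ^ 2
  - C ((k ^ 2 - k + 2 * t)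
      * (k ^ 3 + k ^ 2 * (t - 4) - k * (3 * t - 5) + (4 * t ^ 2 - 2 * t - 2))) * X
  + C (t * (k - t - 1) * (k ^ 2 - 3 * k + 2 * t) * (k ^ 2 - k + 2 * t))

/-- `ψ_e`: the largest real root of `Ψ_e`. -/
noncomputable def psi (e : ℕ) : ℝ := sSup {x : ℝ | (PsiPoly e).IsRoot x}

/-- `ω_e`. -/
noncomputable def omegaNum (e : ℕ) : ℝ :=
  e + 2 + psi e * (psi e + 1) * (psi e ^ 2 - psi e - 2 * e) / (psi e ^ 2 - e)

/-! Fix `l = ψ_e`. On the cone graph, put 1 at the apex and solve the eigenvalue equation for `l` at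
every other vertex, with a vector constant on the parts. Since `Ψ_e(l) = 0`, the defect at the apex
is `(n - ω_e) / l` (`cone_excess`). The sign of `n - ω_e` thus makes this positive vector a super-,
exact or subsolution, and Perron–Frobenius comparison yields the three cases.

Positivity of the vector needs `l > k`, and `ω_e > e + 2` needs `l² - l > 2e`. Both follow from `l >
θ`, where `θ` is the positive root of `x² - x - 2e`: `θ ∈ [k, k + 1]`, `Ψ_e(θ) < 0`
(`psiCubic_neg`), and the leading coefficient is positive. -/

/-! ### Perron–Frobenius comparison for the spectral radius -/

open Classical in
theorem FinGraph.norm_eigenvalue_le_rho (G : FinGraph) [Nonempty G.V] {μ : ℂ} {x : G.V → ℂ}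
    (hx : x ≠ 0) (h : (G.graph.adjMatrix ℂ).mulVec x = μ • x) : ‖μ‖ ≤ G.rho :=
  G.isGreatest_rho.2 ⟨μ, rfl, x, hx, h⟩

open Classical in
theorem FinGraph.abs_eigenvalue_le_rho (G : FinGraph) [Nonempty G.V] {r : ℝ} {x : G.V → ℝ}
    (hx : x ≠ 0) (h : (G.graph.adjMatrix ℝ).mulVec x = r • x) : |r| ≤ G.rho := by
  have := G.norm_eigenvalue_le_rho (μ := r) (x := fun i => (x i : ℂ))
    (fun h0 => hx (funext fun i => by simpa using congrFun h0 i))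
    (funext fun i => by
      have := congrFun h i
      rw [SimpleGraph.adjMatrix_mulVec_apply] at this ⊢
      simp only [Pi.smul_apply, smul_eq_mul] at this ⊢
      rw [← Complex.ofReal_sum, this, Complex.ofReal_mul])
  simpa using this

open Classical in
/-- The moduli of an eigenvector for an eigenvalue of modulus `ρ(G)` are subharmonic. -/
theorem FinGraph.exists_rho_mul_le (G : FinGraph) [Nonempty G.V] :
    ∃ y : G.V → ℝ, y ≠ 0 ∧ (∀ i, 0 ≤ y i) ∧
      ∀ i, G.rho * y i ≤ (G.graph.adjMatrix ℝ).mulVec y i := by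
  obtain ⟨μ, hμ, x, hx, h⟩ := G.isGreatest_rho.1
  refine ⟨fun i => ‖x i‖, fun h0 => hx (funext fun i => by simpa using congrFun h0 i),
    fun i => norm_nonneg _, fun i => ?_⟩
  have := congrFun h i
  rw [SimpleGraph.adjMatrix_mulVec_apply] at this ⊢
  rw [← hμ, ← norm_mul, ← smul_eq_mul, ← Pi.smul_apply, ← this]
  exact norm_sum_le _ _

open Classical in
theorem adjMatrix_dotProduct_comm {V : Type} [Fintype V] (G : SimpleGraph V) (x y : V → ℝ) :
    (G.adjMatrix ℝ).mulVec y ⬝ᵥ x = y ⬝ᵥ (G.adjMatrix ℝ).mulVec x := by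
  rw [dotProduct_comm, Matrix.dotProduct_mulVec, ← Matrix.mulVec_transpose,
    SimpleGraph.transpose_adjMatrix, dotProduct_comm]

theorem dotProduct_pos_of_pos {V : Type} [Fintype V] {x y : V → ℝ} (hx : ∀ i, 0 < x i)
    (hy : ∀ i, 0 ≤ y i) (hy0 : y ≠ 0) : 0 < y ⬝ᵥ x := by
  obtain ⟨i, hi⟩ := Function.ne_iff.1 hy0
  exact Finset.sum_pos' (fun j _ => mul_nonneg (hy j) (hx j).le)
    ⟨i, Finset.mem_univ _, mul_pos ((hy i).lt_of_ne' hi) (hx i)⟩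

-- Pair `x` with a nonnegative `y` such that `ρ y ≤ A y`: by symmetry of `A`, `ρ⟨y, x⟩ ≤ ⟨Ay, x⟩ =
-- ⟨y, Ax⟩ ≤ c⟨y, x⟩`, and `⟨y, x⟩ > 0`.
open Classical in
theorem FinGraph.rho_le_of_mulVec_le (G : FinGraph) [Nonempty G.V] {x : G.V → ℝ} {c : ℝ}
    (hx : ∀ i, 0 < x i) (h : ∀ i, (G.graph.adjMatrix ℝ).mulVec x i ≤ c * x i) : G.rho ≤ c := by
  obtain ⟨y, hy0, hy, hyA⟩ := G.exists_rho_mul_le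
  have h1 : G.rho * (y ⬝ᵥ x) ≤ (G.graph.adjMatrix ℝ).mulVec y ⬝ᵥ x := by
    rw [← smul_eq_mul, ← smul_dotProduct]
    exact Finset.sum_le_sum fun i _ => mul_le_mul_of_nonneg_right (hyA i) (hx i).le
  have h2 : y ⬝ᵥ (G.graph.adjMatrix ℝ).mulVec x ≤ c * (y ⬝ᵥ x) := by
    rw [← smul_eq_mul, ← dotProduct_smul]
    exact Finset.sum_le_sum fun i _ => mul_le_mul_of_nonneg_left (h i) (hy i)
  rw [adjMatrix_dotProduct_comm] at h1
  exact le_of_mul_le_mul_right (h1.trans h2) (dotProduct_pos_of_pos hx hy hy0)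

-- If `ρ = c`, the pairing inequalities are termwise equalities. Strictness at `u` gives `y u = 0`,
-- then `(Ay) u = 0`, so `y` vanishes on all neighbours of `u`, hence everywhere. The dominating
-- vertex replaces irreducibility.
open Classical in
theorem FinGraph.rho_lt_of_mulVec_le (G : FinGraph) [Nonempty G.V] {x : G.V → ℝ} {c : ℝ}
    (hx : ∀ i, 0 < x i) (h : ∀ i, (G.graph.adjMatrix ℝ).mulVec x i ≤ c * x i) (u : G.V)
    (hu : ∀ i, i ≠ u → G.graph.Adj u i) (hlt : (G.graph.adjMatrix ℝ).mulVec x u < c * x u) :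
    G.rho < c := by
  refine (G.rho_le_of_mulVec_le hx h).lt_of_ne fun hc => ?_
  obtain ⟨y, hy0, hy, hyA⟩ := G.exists_rho_mul_le
  have h1 : ∀ i ∈ Finset.univ, G.rho * y i * x i ≤ (G.graph.adjMatrix ℝ).mulVec y i * x i :=
    fun i _ => mul_le_mul_of_nonneg_right (hyA i) (hx i).le
  have h2 : ∀ i ∈ Finset.univ, y i * (G.graph.adjMatrix ℝ).mulVec x i ≤ G.rho * y i * x i :=
    fun i _ => by
      have := mul_le_mul_of_nonneg_left (h i) (hy i)
      rw [hc]; linarith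
  have h3 : ∑ i, (G.graph.adjMatrix ℝ).mulVec y i * x i =
      ∑ i, y i * (G.graph.adjMatrix ℝ).mulVec x i := adjMatrix_dotProduct_comm G.graph x y
  have h4 := (Finset.sum_le_sum h1).antisymm (h3.le.trans (Finset.sum_le_sum h2))
  have h5 := (Finset.sum_le_sum h2).antisymm ((Finset.sum_le_sum h1).trans h3.le)
  have h6 := (Finset.sum_eq_sum_iff_of_le h1).1 h4 u (Finset.mem_univ _)
  have h7 := (Finset.sum_eq_sum_iff_of_le h2).1 h5 u (Finset.mem_univ _)
  have hyu : y u = 0 := by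
    by_contra h0
    have := mul_lt_mul_of_pos_left hlt ((hy u).lt_of_ne' h0)
    rw [hc] at h7
    linarith
  rw [hyu, mul_zero, zero_mul] at h6
  have h8 : (G.graph.adjMatrix ℝ).mulVec y u = 0 :=
    (mul_eq_zero.1 h6.symm).resolve_right (hx u).ne'
  rw [SimpleGraph.adjMatrix_mulVec_apply, Finset.sum_eq_zero_iff_of_nonneg fun i _ => hy i] at h8
  refine hy0 (funext fun i => ?_)
  by_cases hi : i = u
  · rw [hi, hyu]; rfl
  · exact h8 i (by simpa using hu i hi)

-- Rayleigh bound: each eigenvalue of `ρ - A` is `ρ` minus an eigenvalue of `A`, hence nonnegative.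
open Classical in
theorem FinGraph.dotProduct_mulVec_le (G : FinGraph) [Nonempty G.V] (x : G.V → ℝ) :
    x ⬝ᵥ (G.graph.adjMatrix ℝ).mulVec x ≤ G.rho * (x ⬝ᵥ x) := by
  set A := G.graph.adjMatrix ℝ with hA
  have hH : (G.rho • (1 : Matrix G.V G.V ℝ) - A).IsHermitian := by
    rw [Matrix.IsHermitian, Matrix.conjTranspose_eq_transpose_of_trivial]
    simp [hA]
  have hP : (G.rho • (1 : Matrix G.V G.V ℝ) - A).PosSemidef := by
    rw [hH.posSemidef_iff_eigenvalues_nonneg]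
    intro j
    have hv := hH.mulVec_eigenvectorBasis j
    have hv0 : (hH.eigenvectorBasis j).ofLp ≠ 0 := fun h0 =>
      hH.eigenvectorBasis.toBasis.ne_zero j (by simpa using h0)
    have h1 := G.abs_eigenvalue_le_rho (r := G.rho - hH.eigenvalues j) hv0 (by
      rw [Matrix.sub_mulVec, Matrix.smul_mulVec, Matrix.one_mulVec] at hv
      rw [sub_smul, ← hv, sub_sub_cancel])
    have := (abs_le.1 h1).2
    simp only [Pi.zero_apply]
    linarith
  have := hP.dotProduct_mulVec_nonneg x
  rw [Matrix.sub_mulVec, Matrix.smul_mulVec, Matrix.one_mulVec, dotProduct_sub,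
    dotProduct_smul] at this
  simpa using this

open Classical in
theorem FinGraph.lt_rho_of_le_mulVec (G : FinGraph) [Nonempty G.V] {x : G.V → ℝ} {c : ℝ}
    (hx : ∀ i, 0 < x i) (h : ∀ i, c * x i ≤ (G.graph.adjMatrix ℝ).mulVec x i) (u : G.V)
    (hlt : c * x u < (G.graph.adjMatrix ℝ).mulVec x u) : c < G.rho := by
  have h1 : c * (x ⬝ᵥ x) < x ⬝ᵥ (G.graph.adjMatrix ℝ).mulVec x := by
    rw [← smul_eq_mul, ← dotProduct_smul]
    exact Finset.sum_lt_sum (fun i _ => mul_le_mul_of_nonneg_left (h i) (hx i).le)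
      ⟨u, Finset.mem_univ _, mul_lt_mul_of_pos_left hlt (hx u)⟩
  exact lt_of_mul_lt_mul_right (h1.trans_le (G.dotProduct_mulVec_le x))
    (dotProduct_pos_of_pos hx (fun i => (hx i).le) (fun h0 => (hx u).ne' (congrFun h0 u))).le

open Classical in
theorem FinGraph.rho_eq_of_mulVec_eq (G : FinGraph) [Nonempty G.V] {x : G.V → ℝ} {c : ℝ}
    (hx : ∀ i, 0 < x i) (h : ∀ i, (G.graph.adjMatrix ℝ).mulVec x i = c * x i) : G.rho = c := by
  refine (G.rho_le_of_mulVec_le hx fun i => (h i).le).antisymm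
    ((le_abs_self c).trans (G.abs_eigenvalue_le_rho (x := x) (fun h0 => ?_) (funext h)))
  exact (hx (Classical.arbitrary _)).ne' (congrFun h0 _)

/-! ### The cone graph and its equitable partition -/

/-- The case `k + 2 ≤ n` of `graphD`, with the parameters `s = k - t`, `t` and `r = n - k - 2`. -/
def coneGraph (s t r : ℕ) : FinGraph :=
  ⟨_, graphJoin
      ((graphJoin
          (SimpleGraph.completeGraph (Fin s) ⊕g SimpleGraph.completeGraph (Fin 1))
          (SimpleGraph.completeGraph (Fin t)))
        ⊕g SimpleGraph.emptyGraph (Fin r))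
      (SimpleGraph.completeGraph (Fin 1))⟩

/-- The vector constant on the parts of `coneGraph s t r`, with value `1` at the cone vertex. -/
def coneVec (s t r : ℕ) (a b c p : ℝ) : (coneGraph s t r).V → ℝ :=
  Sum.elim (Sum.elim (Sum.elim (Sum.elim (fun _ => a) fun _ => c) fun _ => b) fun _ => p)
    fun _ => 1

/-- The cone vertex. -/
def coneApex (s t r : ℕ) : (coneGraph s t r).V := Sum.inr 0

theorem coneApex_adj (s t r : ℕ) (i : (coneGraph s t r).V) (hi : i ≠ coneApex s t r) :
    (coneGraph s t r).graph.Adj (coneApex s t r) i := by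
  rcases i with i | i
  · simp [coneGraph, coneApex, graphJoin]
  · exact absurd (congrArg Sum.inr (Subsingleton.elim i 0)) hi

theorem coneVec_pos {s t r : ℕ} {a b c p : ℝ} (ha : 0 < a) (hb : 0 < b) (hc : 0 < c)
    (hp : 0 < p) (i : (coneGraph s t r).V) : 0 < coneVec s t r a b c p i := by
  rcases i with (((i | i) | i) | i) | i <;> simp [coneVec, *]

theorem sum_ite_adj_completeGraph {m : ℕ} (i : Fin m) [∀ j, Decidable (i = j)] (a : ℝ) :
    (∑ j : Fin m, if i = j then 0 else a) = (m - 1) * a := by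
  have : ∀ j : Fin m, (if i = j then 0 else a) = a - if i = j then a else 0 := fun j => by
    split_ifs <;> simp
  simp only [this, Finset.sum_sub_distrib]
  rw [Finset.sum_eq_single (f := fun j => if i = j then a else 0) i
    (fun j _ hj => if_neg hj.symm) (by simp)]
  simp
  ring

-- The hypotheses are the eigenvalue equations on the four parts other than the apex, so only the
-- apex keeps a defect.
open Classical in
theorem coneGraph_mulVec_coneVec {s t r : ℕ} {a b c p l : ℝ}
    (ha : (s - 1) * a + t * b + 1 = l * a) (hb : s * a + (t - 1) * b + c + 1 = l * b)
    (hc : t * b + 1 = l * c) (hp : 1 = l * p) (i : (coneGraph s t r).V) :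
    ((coneGraph s t r).graph.adjMatrix ℝ).mulVec (coneVec s t r a b c p) i =
      l * coneVec s t r a b c p i +
        if i = coneApex s t r then s * a + t * b + c + r * p - l else 0 := by
  have hsum : ((coneGraph s t r).graph.adjMatrix ℝ).mulVec (coneVec s t r a b c p) i =
      ∑ j : ((((Fin s ⊕ Fin 1) ⊕ Fin t) ⊕ Fin r) ⊕ Fin 1),
        if (coneGraph s t r).graph.Adj i j then coneVec s t r a b c p j else 0 := by
    rw [SimpleGraph.adjMatrix_mulVec_apply, SimpleGraph.neighborFinset_eq_filter,
      Finset.sum_filter]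
    rfl
  rw [hsum]
  rcases i with (((i | i) | i) | i) | i
  all_goals
    simp [Fintype.sum_sum_type, coneGraph, coneVec, coneApex, graphJoin, Fin.eq_zero,
      sum_ite_adj_completeGraph]
    first | linarith | (rw [← sum_ite_adj_completeGraph i a] at ha; convert ha)

/-! ### The parameters `k`, `t` and the largest root of `Ψ` -/

theorem tNum_lt_kNum (e : ℕ) : tNum e < kNum e := by
  by_contra! h
  have h1 : kNum e + 1 ≤ kNum e := (isGreatest_kNum e).2 (by
    have := choose_kNum_add_tNum e
    change (kNum e + 1).choose 2 ≤ e
    rw [Nat.choose_succ_succ' _ 1, Nat.choose_one_right]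
    simp only [Nat.reduceAdd]
    omega)
  omega

theorem three_le_kNum {e : ℕ} (he : 4 ≤ e) : 3 ≤ kNum e :=
  (isGreatest_kNum e).2 (show Nat.choose 3 2 ≤ e by simp [Nat.choose]; omega)

theorem tNum_pos_of_kNum_eq_three {e : ℕ} (he : 4 ≤ e) (h : kNum e = 3) : 1 ≤ tNum e := by
  have := choose_kNum_add_tNum e
  rw [h] at this
  simp [Nat.choose] at this
  omega

theorem two_mul_eq_kNum_tNum (e : ℕ) : 2 * (e : ℝ) = kNum e ^ 2 - kNum e + 2 * tNum e := by
  have h := congrArg (Nat.cast : ℕ → ℝ) (choose_kNum_add_tNum e)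
  rw [Nat.cast_add, Nat.cast_choose_two] at h
  linarith

/-- The cubic `Ψ` as a function of `k`, `t` and the variable. -/
def psiCubic (k t x : ℝ) : ℝ :=
  ((k - 1) * (k - 2) * (k ^ 2 - 3 * k + 4 * t)) * x ^ 3
  - (k ^ 5 - 6 * k ^ 4 + k ^ 3 * (4 * t + 15) - k ^ 2 * (20 * t + 18)
      + k * (8 * t ^ 2 + 24 * t + 8) - (4 * t ^ 2 + 12 * t)) * x ^ 2
  - ((k ^ 2 - k + 2 * t)
      * (k ^ 3 + k ^ 2 * (t - 4) - k * (3 * t - 5) + (4 * t ^ 2 - 2 * t - 2))) * x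
  + (t * (k - t - 1) * (k ^ 2 - 3 * k + 2 * t) * (k ^ 2 - k + 2 * t))

theorem eval_PsiPoly (e : ℕ) (x : ℝ) :
    (PsiPoly e).eval x = psiCubic (kNum e) (tNum e) x := by
  simp [PsiPoly, psiCubic]

theorem leadingCoeff_pos_of_parameters {k t : ℕ} (hk : 3 ≤ k) (h3 : k = 3 → 1 ≤ t) :
    (0 : ℝ) < ((k : ℝ) - 1) * (k - 2) * (k ^ 2 - 3 * k + 4 * t) := by
  have hk' : (3 : ℝ) ≤ k := by exact_mod_cast hk
  refine mul_pos (mul_pos (by linarith) (by linarith)) ?_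
  rcases hk.eq_or_lt with h | h
  · have : (1 : ℝ) ≤ t := by exact_mod_cast h3 h.symm
    nlinarith
  · have : (4 : ℝ) ≤ k := by exact_mod_cast h
    nlinarith [(Nat.cast_nonneg t : (0 : ℝ) ≤ t)]

/-- Linear interpolant, in `y`, of the remainder of `Ψ` modulo `x ^ 2 - x - (k ^ 2 - k + 2 t)`. -/
def psiRem (k t y : ℝ) : ℝ :=
  ((k - 1) * (k - 2) * (k ^ 2 - 3 * k + 4 * t) * (1 + (k ^ 2 - k + 2 * t))
    - (k ^ 5 - 6 * k ^ 4 + k ^ 3 * (4 * t + 15) - k ^ 2 * (20 * t + 18)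
      + k * (8 * t ^ 2 + 24 * t + 8) - (4 * t ^ 2 + 12 * t))
    - (k ^ 2 - k + 2 * t)
      * (k ^ 3 + k ^ 2 * (t - 4) - k * (3 * t - 5) + (4 * t ^ 2 - 2 * t - 2))) * y
  + ((k ^ 2 - k + 2 * t) * ((k - 1) * (k - 2) * (k ^ 2 - 3 * k + 4 * t)
      - (k ^ 5 - 6 * k ^ 4 + k ^ 3 * (4 * t + 15) - k ^ 2 * (20 * t + 18)
      + k * (8 * t ^ 2 + 24 * t + 8) - (4 * t ^ 2 + 12 * t)))
    + t * (k - t - 1) * (k ^ 2 - 3 * k + 2 * t) * (k ^ 2 - k + 2 * t))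

/-- Shifts to free natural parameters for which the negated remainders below expand without negative
coefficients. -/
theorem exists_parameter_form {k t : ℕ} (hk : 3 ≤ k) (ht : t < k) (h3 : k = 3 → 1 ≤ t) :
    (∃ m : ℕ, k = 4 + m ∧ t = 0) ∨ (∃ m : ℕ, k = 3 + m ∧ t = 1) ∨
      ∃ m v : ℕ, k = 3 + m + v ∧ t = 2 + m := by
  rcases t with _ | _ | t
  · exact Or.inl ⟨k - 4, by omega, rfl⟩
  · exact Or.inr (Or.inl ⟨k - 3, by omega, rfl⟩)
  · exact Or.inr (Or.inr ⟨t, k - 3 - t, by omega, by omega⟩)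

theorem psiRem_left_neg {k t : ℕ} (hk : 3 ≤ k) (ht : t < k) (h3 : k = 3 → 1 ≤ t) :
    psiRem k t k < 0 := by
  rw [← neg_pos]
  obtain ⟨m, rfl, rfl⟩ | ⟨m, rfl, rfl⟩ | ⟨m, v, rfl, rfl⟩ := exists_parameter_form hk ht h3
  all_goals
    unfold psiRem
    push_cast
    ring_nf
    positivity

theorem psiRem_right_neg {k t : ℕ} (hk : 3 ≤ k) (ht : t < k) (h3 : k = 3 → 1 ≤ t) :
    psiRem k t (k + 1) < 0 := by
  rw [← neg_pos]
  obtain ⟨m, rfl, rfl⟩ | ⟨m, rfl, rfl⟩ | ⟨m, v, rfl, rfl⟩ := exists_parameter_form hk ht h3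
  all_goals
    unfold psiRem
    push_cast
    ring_nf
    positivity

/-- Modulo the quadratic relation `Ψ` becomes affine in `x`, so its signs at the endpoints `k` and
`k + 1` suffice. -/
theorem psiCubic_neg {k t : ℕ} (hk : 3 ≤ k) (ht : t < k) (h3 : k = 3 → 1 ≤ t) {x : ℝ}
    (hx : x ^ 2 = x + ((k : ℝ) ^ 2 - k + 2 * t)) (h1 : (k : ℝ) ≤ x) (h2 : x ≤ k + 1) :
    psiCubic k t x < 0 := by
  have h : psiCubic k t x = psiRem k t x := by
    unfold psiCubic psiRem
    linear_combination ((((k : ℝ) - 1) * (k - 2) * (k ^ 2 - 3 * k + 4 * t)) * (x + 1)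
      - (k ^ 5 - 6 * k ^ 4 + k ^ 3 * (4 * t + 15) - k ^ 2 * (20 * t + 18)
      + k * (8 * t ^ 2 + 24 * t + 8) - (4 * t ^ 2 + 12 * t))) * hx
  have h' : psiRem k t x = (k + 1 - x) * psiRem k t k + (x - k) * psiRem k t (k + 1) := by
    unfold psiRem
    ring
  have hl := psiRem_left_neg hk ht h3
  have hr := psiRem_right_neg hk ht h3
  rw [h, h']
  rcases h1.eq_or_lt with h0 | h0
  · rw [← h0]; linarith
  · nlinarith [mul_pos (sub_pos.2 h0) (neg_pos.2 hr),
      mul_nonneg (sub_nonneg.2 h2) (neg_pos.2 hl).le]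

theorem exists_le_cubic_pos {a : ℝ} (ha : 0 < a) (b c d x : ℝ) :
    ∃ y, x ≤ y ∧ 0 < a * y ^ 3 - b * y ^ 2 - c * y + d := by
  have hlim := (C a * X ^ 3 + C (-b) * X ^ 2 + C (-c) * X + C d).tendsto_atTop_of_leadingCoeff_nonneg
    (by rw [degree_cubic ha.ne']; norm_num) (by rw [leadingCoeff_cubic ha.ne']; exact ha.le)
  obtain ⟨y, hy, hy'⟩ := ((hlim.eventually_gt_atTop 0).and (Filter.eventually_ge_atTop x)).exists
  refine ⟨y, hy', hy.trans_eq ?_⟩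
  simp
  ring

theorem exists_pos_eval_PsiPoly {e : ℕ} (he : 4 ≤ e) (x : ℝ) :
    ∃ y, x ≤ y ∧ 0 < (PsiPoly e).eval y := by
  simp only [eval_PsiPoly]
  exact exists_le_cubic_pos
    (leadingCoeff_pos_of_parameters (three_le_kNum he) (tNum_pos_of_kNum_eq_three he)) _ _ _ x

theorem exists_isRoot_PsiPoly {e : ℕ} (he : 4 ≤ e) :
    ∃ x : ℝ, (PsiPoly e).IsRoot x ∧ (kNum e : ℝ) < x ∧ 2 * (e : ℝ) < x ^ 2 - x := by
  have hk := three_le_kNum he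
  have ht := tNum_lt_kNum e
  have hE := two_mul_eq_kNum_tNum e
  have hk' : (3 : ℝ) ≤ kNum e := by exact_mod_cast hk
  have ht' : (tNum e : ℝ) + 1 ≤ kNum e := by exact_mod_cast ht
  have ht0 : (0 : ℝ) ≤ tNum e := Nat.cast_nonneg _
  set θ : ℝ := (1 + √(1 + 8 * e)) / 2 with hθ
  have hsq : √(1 + 8 * (e : ℝ)) ^ 2 = 1 + 8 * e := Real.sq_sqrt (by positivity)
  have hθ2 : θ ^ 2 = θ + ((kNum e : ℝ) ^ 2 - kNum e + 2 * tNum e) := by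
    rw [← hE, hθ]
    linear_combination hsq / 4
  have hθ0 : 0 < θ := by positivity
  -- Both bounds hold because `0 ≤ t ≤ k - 1` puts `2e` between `k(k - 1)` and `(k + 1)k`.
  have h1 : (kNum e : ℝ) ≤ θ := by
    by_contra! h
    nlinarith
  have h2 : θ ≤ kNum e + 1 := by
    by_contra! h
    nlinarith
  have hneg := psiCubic_neg hk ht (tNum_pos_of_kNum_eq_three he) hθ2 h1 h2
  obtain ⟨y, hy, hypos⟩ := exists_pos_eval_PsiPoly he θ
  obtain ⟨x, ⟨hx1, -⟩, hx⟩ := intermediate_value_Icc hy (PsiPoly e).continuous.continuousOn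
    ⟨(eval_PsiPoly e θ ▸ hneg.le : (PsiPoly e).eval θ ≤ 0), hypos.le⟩
  have hlt : θ < x := hx1.lt_of_ne fun h => by
    rw [← h] at hx
    exact hneg.ne ((eval_PsiPoly e θ).symm.trans hx)
  refine ⟨x, hx, h1.trans_lt hlt, ?_⟩
  rw [hE]
  nlinarith

theorem isGreatest_psi {e : ℕ} (he : 4 ≤ e) : IsGreatest {x : ℝ | (PsiPoly e).IsRoot x} (psi e) := by
  obtain ⟨x, hx, -⟩ := exists_isRoot_PsiPoly he
  have h0 : PsiPoly e ≠ 0 := fun h => by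
    obtain ⟨y, -, hy⟩ := exists_pos_eval_PsiPoly he 0
    simp [h] at hy
  have hfin := finite_setOfPred_isRoot h0
  exact ⟨Set.Nonempty.csSup_mem ⟨x, hx⟩ hfin, fun y hy => le_csSup hfin.bddAbove hy⟩

theorem kNum_lt_psi {e : ℕ} (he : 4 ≤ e) : (kNum e : ℝ) < psi e := by
  obtain ⟨x, hx, h, -⟩ := exists_isRoot_PsiPoly he
  exact h.trans_le ((isGreatest_psi he).2 hx)

theorem two_mul_lt_psi_sq_sub {e : ℕ} (he : 4 ≤ e) : 2 * (e : ℝ) < psi e ^ 2 - psi e := by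
  obtain ⟨x, hx, h1, h2⟩ := exists_isRoot_PsiPoly he
  have := (isGreatest_psi he).2 hx
  have hk : (3 : ℝ) ≤ kNum e := by exact_mod_cast three_le_kNum he
  nlinarith

/-! ### The almost-eigenvector and its defect at the apex -/

/-- The characteristic determinant of the quotient matrix of `(K_{k-t} + K_1) ∨ K_t`. -/
def quotientDet (k t l : ℝ) : ℝ :=
  l * ((l - k + t + 1) * (l - t + 1) - t * (k - t)) - t * (l - k + t + 1)

/-- The graph `(K_{k-t} + K_1) ∨ K_t` has maximum degree `k`, so `l > k` lies beyond its spectrum.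
The substitutions leave only nonnegative coefficients. -/
theorem quotientDet_pos {k t l : ℝ} (ht : 0 ≤ t) (htk : t + 1 ≤ k) (hl : k < l) :
    0 < quotientDet k t l := by
  obtain ⟨d, rfl⟩ : ∃ d, k = t + 1 + d := ⟨k - t - 1, by ring⟩
  obtain ⟨u, rfl⟩ : ∃ u, l = t + 1 + d + u := ⟨l - (t + 1 + d), by ring⟩
  have hd : 0 ≤ d := by linarith
  have hu : 0 < u := by linarith
  unfold quotientDet
  ring_nf
  positivity

/-- After clearing denominators the two sides differ by a multiple of `Ψ`. The right side is the
apex defect of the cone over `K_{1,e} + (n-e-2)K_1`, so `Ψ` expresses that both cones reach `l` at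
the same `n`. -/
theorem cone_excess {k t l e n : ℝ} (hP : quotientDet k t l ≠ 0) (hl : l ≠ 0) (hle : l ^ 2 - e ≠ 0)
    (he : 2 * e = k ^ 2 - k + 2 * t) (hΨ : psiCubic k t l = 0) :
    (k - t) * (l * (l + 1) / quotientDet k t l)
      + t * (((k - t) * l + (l + 1) * (l - k + t + 1)) / quotientDet k t l)
      + (l - k + t + 1) * (l + 1) / quotientDet k t l + (n - k - 2) * (1 / l) - l =
    (n - (e + 2 + l * (l + 1) * (l ^ 2 - l - 2 * e) / (l ^ 2 - e))) / l := by
  have he' : e = (k ^ 2 - k + 2 * t) / 2 := by linarith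
  field_simp
  rw [he']
  unfold quotientDet
  unfold psiCubic at hΨ
  linear_combination (-1/4) * hΨ

theorem graphD_eq_coneGraph {n e : ℕ} (h : kNum e + 2 ≤ n) :
    graphD n e = coneGraph (kNum e - tNum e) (tNum e) (n - kNum e - 2) :=
  if_pos h

theorem psi_sq_sub_pos {e : ℕ} (he : 4 ≤ e) : 0 < psi e ^ 2 - (e : ℝ) := by
  have h1 := kNum_lt_psi he
  have h2 := two_mul_lt_psi_sq_sub he
  have : (0 : ℝ) ≤ kNum e := Nat.cast_nonneg _
  have : (0 : ℝ) ≤ e := Nat.cast_nonneg _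
  linarith

open Classical in
/-- A positive vector satisfying the eigenvalue equation for `ψ_e` except at the cone vertex. -/
theorem exists_almost_eigenvector {n e : ℕ} (he : 4 ≤ e) (hn : kNum e + 2 ≤ n) :
    ∃ (x : (graphD n e).V → ℝ) (u : (graphD n e).V), (∀ i, 0 < x i) ∧ x u = 1 ∧
      (∀ i, i ≠ u → (graphD n e).graph.Adj u i) ∧
      ∀ i, ((graphD n e).graph.adjMatrix ℝ).mulVec x i =
        psi e * x i + if i = u then (n - omegaNum e) / psi e else 0 := by
  rw [graphD_eq_coneGraph hn]
  have htk := tNum_lt_kNum e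
  have hl := kNum_lt_psi he
  have hk : (3 : ℝ) ≤ kNum e := by exact_mod_cast three_le_kNum he
  have htk' : (tNum e : ℝ) + 1 ≤ kNum e := by exact_mod_cast htk
  have ht : (0 : ℝ) ≤ tNum e := Nat.cast_nonneg _
  have hs : ((kNum e - tNum e : ℕ) : ℝ) = kNum e - tNum e := Nat.cast_sub htk.le
  have hr : ((n - kNum e - 2 : ℕ) : ℝ) = n - kNum e - 2 := by
    rw [Nat.sub_sub, Nat.cast_sub hn]
    push_cast
    ring
  have hΨ : psiCubic (kNum e) (tNum e) (psi e) = 0 :=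
    (eval_PsiPoly e _).symm.trans (isGreatest_psi he).1
  have hex := fun hP hl => cone_excess (n := n) hP hl (psi_sq_sub_pos he).ne'
    (two_mul_eq_kNum_tNum e) hΨ
  have hP := quotientDet_pos ht htk' hl
  unfold omegaNum
  generalize psi e = l at *
  generalize (kNum e : ℝ) = k at *
  have hl0 : 0 < l := by linarith
  have hp : 0 < l - k + tNum e + 1 := by linarith
  have hq : 0 ≤ (k - tNum e) * l := mul_nonneg (by linarith) hl0.le
  -- Cramer's rule for the three-part linear system with right-hand side 1, of determinant
  -- `quotientDet`; the isolated vertices get `1 / l`.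
  refine ⟨coneVec _ _ _ (l * (l + 1) / quotientDet k (tNum e) l)
    (((k - tNum e) * l + (l + 1) * (l - k + tNum e + 1)) / quotientDet k (tNum e) l)
    ((l - k + tNum e + 1) * (l + 1) / quotientDet k (tNum e) l) (1 / l), coneApex _ _ _,
    coneVec_pos (by positivity) (by positivity) (by positivity) (by positivity), rfl,
    coneApex_adj _ _ _, fun i => ?_⟩
  rw [coneGraph_mulVec_coneVec (l := l) _ _ _ _ i]
  · rw [hs, hr, hex hP.ne' hl0.ne']
  all_goals
    try rw [hs]
    have hP' := hP.ne'
    field_simp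
    try (unfold quotientDet; ring)

/-! ### Comparison of `ρ` with `ψ_e` -/

theorem rho_completeGraph_le {n : ℕ} (hn : n ≠ 0) :
    (⟨Fin n, SimpleGraph.completeGraph (Fin n)⟩ : FinGraph).rho ≤ n - 1 := by
  classical
  have : Nonempty (Fin n) := ⟨⟨0, Nat.pos_of_ne_zero hn⟩⟩
  refine FinGraph.rho_le_of_mulVec_le _ (x := fun _ => 1) (fun _ => one_pos) fun i => ?_
  have h := sum_ite_adj_completeGraph i 1
  rw [SimpleGraph.adjMatrix_mulVec_apply, SimpleGraph.neighborFinset_eq_filter, Finset.sum_filter,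
    ← h]
  refine (Finset.sum_congr rfl fun j _ => ?_).le
  simp [SimpleGraph.completeGraph]

theorem mainTheorem5 (e : ℕ) (he : 4 ≤ e) :
    IsGreatest {x : ℝ | (PsiPoly e).IsRoot x} (psi e) ∧
    psi e ^ 2 - (e : ℝ) ≠ 0 ∧
    (e : ℝ) + 2 < omegaNum e ∧
    ∀ n : ℕ,
      (bNum e ≤ n → (n : ℝ) < omegaNum e → (graphD n e).rho < psi e) ∧
      ((n : ℝ) = omegaNum e → (graphD n e).rho = psi e) ∧
      (omegaNum e < (n : ℝ) → psi e < (graphD n e).rho) := by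
  classical
  have hk := three_le_kNum he
  have hk' : (3 : ℝ) ≤ kNum e := by exact_mod_cast hk
  have hψ : 0 < psi e := by linarith [kNum_lt_psi he]
  have hω : (e : ℝ) + 2 < omegaNum e := by
    have h1 := psi_sq_sub_pos he
    have h2 : 0 < psi e ^ 2 - psi e - 2 * e := by linarith [two_mul_lt_psi_sq_sub he]
    have : 0 < psi e * (psi e + 1) * (psi e ^ 2 - psi e - 2 * e) / (psi e ^ 2 - e) := by positivity
    unfold omegaNum
    linarith
  refine ⟨isGreatest_psi he, (psi_sq_sub_pos he).ne', hω, fun n => ?_⟩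
  -- From `k ≥ 3`, `2e ≥ k(k - 1) ≥ 2k`, so `k + 2 ≤ e + 2 < ω_e` and the cone form applies.
  have hlarge : omegaNum e ≤ n → kNum e + 2 ≤ n := fun h => by
    have h1 : (e : ℝ) + 2 ≤ n := (hω.trans_le h).le
    have h2 : (kNum e : ℝ) ≤ e := by nlinarith [two_mul_eq_kNum_tNum e,
      (Nat.cast_nonneg (tNum e) : (0 : ℝ) ≤ tNum e)]
    have h3 : (kNum e : ℝ) + 2 ≤ n := by linarith
    exact_mod_cast h3
  refine ⟨fun hb hlt => ?_, fun heq => ?_, fun hgt => ?_⟩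
  · by_cases hn : kNum e + 2 ≤ n
    · obtain ⟨x, u, hx, hxu, hu, hA⟩ := exists_almost_eigenvector he hn
      have : Nonempty (graphD n e).V := ⟨u⟩
      have hδ : (n - omegaNum e) / psi e < 0 := div_neg_of_neg_of_pos (by linarith) hψ
      refine FinGraph.rho_lt_of_mulVec_le _ hx (fun i => ?_) u hu ?_
      · rw [hA]
        split_ifs <;> linarith
      · rw [hA, if_pos rfl]
        linarith
    -- Here `b_e ≥ k + 1` leaves only `K_{k+1}`, whose spectral radius is at most `k < ψ_e`.
    · have hn' : n = kNum e + 1 := by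
        unfold bNum at hb
        split_ifs at hb <;> omega
      have h := rho_completeGraph_le (n := n) (by omega)
      rw [graphD, if_neg hn]
      refine h.trans_lt ?_
      rw [hn']
      push_cast
      linarith [kNum_lt_psi he]
  · obtain ⟨x, u, hx, -, -, hA⟩ := exists_almost_eigenvector he (hlarge heq.ge)
    have : Nonempty (graphD n e).V := ⟨u⟩
    refine FinGraph.rho_eq_of_mulVec_eq _ hx fun i => ?_
    rw [hA, heq]
    simp
  · obtain ⟨x, u, hx, -, -, hA⟩ := exists_almost_eigenvector he (hlarge hgt.le)
    have : Nonempty (graphD n e).V := ⟨u⟩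
    have hδ : 0 < (n - omegaNum e) / psi e := div_pos (by linarith) hψ
    refine FinGraph.lt_rho_of_le_mulVec _ hx (fun i => ?_) u ?_
    · rw [hA]
      split_ifs <;> linarith
    · rw [hA, if_pos rfl]
      linarith
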